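/- Let $0<q<1$. For $a\in\mathbb{C}$ put $(a;q)_n=\prod_{k=0}^{n-1}(1-aq^k)$ for integers $n\ge 0$, $(a;q)_\infty=\prod_{k=0}^{\infty}(1-aq^k)$, and $(a_1,a_2;q)_n=(a_1;q)_n(a_2;q)_n$ for $n\in\{0,1,2,\dots\}\cup\{\infty\}$. (i) Let $a,b\in\mathbb{C}$ satisfy $|ab|<1$ and $aq^k\neq 1$, $bq^k\neq 1$ for all integers $k\ge 1$. Then $$\frac{(q,ab;q)_\infty}{(qa,qb;q)_\infty}\sum_{n=0}^\infty\frac{(q/a,q/b;q)_n(-ab)^n}{(q^2;q^2)_n} =\sum_{n=0}^\infty\sum_{j=-n}^{n}(-1)^j\frac{(1-q^{2n+1})(q/a,q/b;q)_n(ab)^nq^{n^2-j^2}}{(qa,qb;q)_n},$$ where the series over $n$ on both sides converge. Here $(q/a;q)_na^n$ is understood as the polynomial $\prod_{k=0}^{n-1}(a-q^{k+1})$, and likewise for $b$, so that the values $a=0$ and $b=0$ are allowed. (ii) In particular (case $a=1$, $b=0$) the Andrews–Dyson–Hickerson identity holds: $$\sum_{n=0}^\infty\frac{q^{n(n+1)/2}}{(-q;q)_n}=\sum_{n=0}^\infty\sum_{j=-n}^{n}(-1)^{n+j}(1-q^{2n+1})q^{(3n^2+n)/2-j^2},$$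 where the series over $n$ on both sides converge. -/

import Mathlib

/-- The finite `q`-shifted factorial `(a; q)_n = ∏_{k=0}^{n-1} (1 - a q^k)`. -/
noncomputable def qShifted (a q : ℂ) (n : ℕ) : ℂ :=
  ∏ k ∈ Finset.range n, (1 - a * q ^ k)

/-- The infinite `q`-shifted factorial `(a; q)_∞ = ∏_{k=0}^∞ (1 - a q^k)`. -/
noncomputable def qShiftedInf (a q : ℂ) : ℂ :=
  ∏' k : ℕ, (1 - a * q ^ k)

/-- The polynomial `(q/a; q)_n a^n = ∏_{k=0}^{n-1} (a - q^{k+1})` in `a`, which gives the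
expression `(q/a; q)_n a^n` its (limiting) meaning at `a = 0`. -/
noncomputable def qShiftedScaled (a q : ℂ) (n : ℕ) : ℂ :=
  ∏ k ∈ Finset.range n, (a - q ^ (k + 1))

/-- The infinite product defining `(a; q)_∞` converges for `|q| < 1`. -/
theorem multipliable_qShiftedInf (a q : ℂ) (hq : ‖q‖ < 1) :
    Multipliable fun k : ℕ => 1 - a * q ^ k := by
  have h : Summable fun k : ℕ => ‖-(a * q ^ k)‖ := by
    simp only [norm_neg, norm_mul, norm_pow]
    exact (summable_geometric_of_lt_one (norm_nonneg q) hq).mul_left _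
  simpa [sub_eq_add_neg] using multipliable_one_add_of_summable h

/-- For `a ≠ 0` the polynomial is literally `(q/a; q)_n a^n`. -/
theorem qShiftedScaled_eq (a q : ℂ) (n : ℕ) (ha : a ≠ 0) :
    qShiftedScaled a q n = qShifted (q / a) q n * a ^ n := by
  unfold qShiftedScaled qShifted
  rw [← Finset.card_range n, ← Finset.prod_const, Finset.card_range, ← Finset.prod_mul_distrib]
  refine Finset.prod_congr rfl fun k _ => ?_
  field_simp
  ring

/-- The polynomial is continuous in `a`, so its value at `0` is the limit of
`(q/a; q)_n a^n` as `a → 0`. -/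
theorem continuous_qShiftedScaled (q : ℂ) (n : ℕ) :
    Continuous fun a : ℂ => qShiftedScaled a q n := by
  unfold qShiftedScaled
  fun_prop

/-! A Bailey pair relative to q (`sum_heckeInnerSum_div`) expands (-1)^n/(q²;q²)_n as a sum over r ≤
n with numerators (1 - q^(2r+1)) ∑_{|j|≤r} (-1)^j q^(r²-j²). It follows from a telescoping sum in r
(`sum_Icc_telescope`) and Gauss's alternating q-binomial sum (`sum_Icc_neg_one_zpow_div`). Inserting
it into the left-hand series gives an absolutely convergent double series in r and m = n - r
(`summable_baileyTerm`). Its diagonals recover the left side; each row is a q-Gauss series with s =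
q^(r+1), evaluated by `qGauss_sum`. Part (ii) is a = 1, b = 0, where the prefactor is 1. -/

open Filter Topology

/-! ### Finite and infinite q-shifted factorials. -/

/-- The product `∏_{k=0}^{n-1} (a - s q^k)`, equal to `(s/a; q)_n a^n` when `a ≠ 0`. -/
noncomputable def shiftedDiff (a s q : ℂ) (n : ℕ) : ℂ :=
  ∏ k ∈ Finset.range n, (a - s * q ^ k)

theorem qShiftedScaled_eq_shiftedDiff (a q : ℂ) (n : ℕ) :
    qShiftedScaled a q n = shiftedDiff a q q n :=
  Finset.prod_congr rfl fun k _ => by ring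

@[simp] theorem shiftedDiff_zero (a s q : ℂ) : shiftedDiff a s q 0 = 1 := rfl

theorem shiftedDiff_succ (a s q : ℂ) (n : ℕ) :
    shiftedDiff a s q (n + 1) = shiftedDiff a s q n * (a - s * q ^ n) :=
  Finset.prod_range_succ _ _

theorem shiftedDiff_add (a s q : ℂ) (r m : ℕ) :
    shiftedDiff a s q (r + m) = shiftedDiff a s q r * shiftedDiff a (s * q ^ r) q m := by
  unfold shiftedDiff
  rw [Finset.prod_range_add]
  congr 1
  exact Finset.prod_congr rfl fun k _ => by ring

theorem shiftedDiff_mul_q_succ (a s q : ℂ) (n : ℕ) :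
    shiftedDiff (a * q) s q (n + 1) = q ^ n * (a * q - s) * shiftedDiff a s q n := by
  unfold shiftedDiff
  rw [Finset.prod_range_succ', pow_zero, mul_one]
  have : ∀ k ∈ Finset.range n, a * q - s * q ^ (k + 1) = q * (a - s * q ^ k) := fun k _ => by ring
  rw [Finset.prod_congr rfl this, Finset.prod_mul_distrib, Finset.prod_const, Finset.card_range]
  ring

@[simp] theorem qShifted_zero (a q : ℂ) : qShifted a q 0 = 1 := rfl

theorem qShifted_succ (a q : ℂ) (n : ℕ) :
    qShifted a q (n + 1) = qShifted a q n * (1 - a * q ^ n) :=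
  Finset.prod_range_succ _ _

theorem qShifted_add (a q : ℂ) (r m : ℕ) :
    qShifted a q (r + m) = qShifted a q r * qShifted (a * q ^ r) q m := by
  unfold qShifted
  rw [Finset.prod_range_add]
  congr 1
  exact Finset.prod_congr rfl fun k _ => by ring

theorem qShifted_ne_zero {a q : ℂ} (h : ∀ k, a * q ^ k ≠ 1) (n : ℕ) : qShifted a q n ≠ 0 :=
  Finset.prod_ne_zero_iff.2 fun k _ => sub_ne_zero.2 (h k).symm

theorem mul_pow_ne_one {a q : ℂ} (ha : ‖a‖ < 1) (hq : ‖q‖ < 1) (k : ℕ) : a * q ^ k ≠ 1 := by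
  intro h
  have h1 : ‖a * q ^ k‖ = 1 := by rw [h, norm_one]
  rw [norm_mul, norm_pow] at h1
  nlinarith [pow_le_one₀ (norm_nonneg q) hq.le (n := k), norm_nonneg a,
    pow_nonneg (norm_nonneg q) k]

theorem tendsto_qShifted {q : ℂ} (a : ℂ) (hq : ‖q‖ < 1) :
    Tendsto (qShifted a q) atTop (𝓝 (qShiftedInf a q)) :=
  (multipliable_qShiftedInf a q hq).tendsto_prod_tprod_nat

theorem qShiftedInf_ne_zero {a q : ℂ} (hq : ‖q‖ < 1) (h : ∀ k, a * q ^ k ≠ 1) :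
    qShiftedInf a q ≠ 0 := by
  have hs : Summable fun k : ℕ => ‖-(a * q ^ k)‖ := by
    simp only [norm_neg, norm_mul, norm_pow]
    exact (summable_geometric_of_lt_one (norm_nonneg q) hq).mul_left _
  have := tprod_one_add_ne_zero_of_summable (f := fun k : ℕ => -(a * q ^ k))
    (fun k => by rw [← sub_eq_add_neg]; exact sub_ne_zero.2 (h k).symm) hs
  simpa only [← sub_eq_add_neg, qShiftedInf] using this

theorem qShiftedInf_eq_mul {q : ℂ} (a : ℂ) (hq : ‖q‖ < 1) (r : ℕ) :
    qShiftedInf a q = qShifted a q r * qShiftedInf (a * q ^ r) q := by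
  have h1 := (tendsto_qShifted a hq).comp (tendsto_add_atTop_nat r)
  have h2 := (tendsto_qShifted (a * q ^ r) hq).const_mul (qShifted a q r)
  refine tendsto_nhds_unique h1 (h2.congr fun m => ?_)
  rw [← qShifted_add, Function.comp_apply, add_comm]

theorem qShiftedInf_zero (q : ℂ) : qShiftedInf 0 q = 1 := by
  simp [qShiftedInf]

theorem summable_prod_range_of_tendsto {R : Type*} [NormedCommRing R]
    [CompleteSpace R] [NormMulClass R]
    {u : ℕ → R} {l : R} (hu : Tendsto u atTop (𝓝 l)) (hl : ‖l‖ < 1) :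
    Summable fun m => ∏ k ∈ Finset.range m, u k := by
  obtain ⟨ρ, hρ, hρ1⟩ := exists_between hl
  refine summable_of_ratio_norm_eventually_le hρ1 ?_
  filter_upwards [hu.norm.eventually_le_const hρ] with n hn
  rw [Finset.prod_range_succ, norm_mul, mul_comm]
  exact mul_le_mul_of_nonneg_right hn (norm_nonneg _)

theorem tendsto_const_mul_pow {q : ℂ} (c : ℂ) (hq : ‖q‖ < 1) :
    Tendsto (fun n : ℕ => c * q ^ n) atTop (𝓝 0) := by
  simpa using (tendsto_pow_atTop_nhds_zero_of_norm_lt_one hq).const_mul c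

/-! ### The q-Gauss summation. -/

/-- The summand of the `q`-Gauss series with numerator parameters `s/a`, `s/b`, denominator
parameter `s ^ 2` and argument `a b`. -/
noncomputable def qGaussTerm (a b s q : ℂ) (m : ℕ) : ℂ :=
  shiftedDiff a s q m * shiftedDiff b s q m / (qShifted q q m * qShifted (s ^ 2) q m)

theorem qGaussTerm_eq_prod (a b s q : ℂ) (m : ℕ) :
    qGaussTerm a b s q m = ∏ k ∈ Finset.range m,
      (a - s * q ^ k) * (b - s * q ^ k) / ((1 - q * q ^ k) * (1 - s ^ 2 * q ^ k)) := by
  simp only [qGaussTerm, shiftedDiff, qShifted, Finset.prod_div_distrib, Finset.prod_mul_distrib]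

theorem qGaussTerm_comm (a b s q : ℂ) (m : ℕ) : qGaussTerm a b s q m = qGaussTerm b a s q m := by
  rw [qGaussTerm, qGaussTerm, mul_comm (shiftedDiff a s q m)]

theorem summable_qGaussTerm {a b q : ℂ} (s : ℂ) (hq : ‖q‖ < 1) (hab : ‖a * b‖ < 1) :
    Summable (qGaussTerm a b s q) := by
  simp only [funext (qGaussTerm_eq_prod a b s q)]
  refine summable_prod_range_of_tendsto (R := ℂ) (l := (a - 0) * (b - 0) / ((1 - 0) * (1 - 0)))
    (((((tendsto_const_mul_pow s hq).const_sub a).mul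
    ((tendsto_const_mul_pow s hq).const_sub b))).div
    (((tendsto_const_mul_pow q hq).const_sub 1).mul
    ((tendsto_const_mul_pow (s ^ 2) hq).const_sub 1)) (by simp)) (by simpa using hab)

/-- The contiguous relation a → aq, exact for partial sums up to a boundary term that vanishes as N
→ ∞ when |ab| < 1. -/
theorem sum_range_qGaussTerm_sub {q s : ℂ} (a b : ℂ) (hq : ‖q‖ < 1)
    (hs : ∀ k, s ^ 2 * q ^ k ≠ 1) (N : ℕ) :
    ∑ m ∈ Finset.range (N + 1),
      ((1 - a * b) * qGaussTerm a b s q m - (1 - a * s) * qGaussTerm (a * q) b s q m) =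
      -a * (qGaussTerm a b s q N * (b - s * q ^ N)) := by
  induction N with
  | zero => simp [qGaussTerm]; ring
  | succ N ih =>
    rw [Finset.sum_range_succ, ih]
    have h1 := qShifted_ne_zero (mul_pow_ne_one hq hq) N
    have h2 := qShifted_ne_zero hs N
    have h3 : 1 - q * q ^ N ≠ 0 := sub_ne_zero.2 (mul_pow_ne_one hq hq N).symm
    have h4 : 1 - s ^ 2 * q ^ N ≠ 0 := sub_ne_zero.2 (hs N).symm
    simp only [qGaussTerm, shiftedDiff_mul_q_succ]
    simp only [shiftedDiff_succ, qShifted_succ, pow_succ q]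
    generalize q ^ N = x at h3 h4 ⊢
    generalize hd : 1 - q * x = d at h3 ⊢
    field_simp
    rw [← hd]
    ring

theorem tsum_qGaussTerm_mul {q s a b : ℂ} (hq : ‖q‖ < 1) (hab : ‖a * b‖ < 1)
    (hs : ∀ k, s ^ 2 * q ^ k ≠ 1) :
    (1 - a * b) * ∑' m, qGaussTerm a b s q m =
      (1 - a * s) * ∑' m, qGaussTerm (a * q) b s q m := by
  have hab' : ‖a * q * b‖ < 1 := by
    rw [mul_right_comm, norm_mul]
    exact mul_lt_one_of_nonneg_of_lt_one_left (norm_nonneg _) hab hq.le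
  have h1 := summable_qGaussTerm s hq hab
  have h2 := summable_qGaussTerm s hq hab'
  have h := ((h1.hasSum.mul_left (1 - a * b)).sub
    (h2.hasSum.mul_left (1 - a * s))).tendsto_sum_nat.comp (tendsto_add_atTop_nat 1)
  have h0 := (h1.tendsto_atTop_zero.mul
    ((tendsto_const_mul_pow s hq).const_sub b)).const_mul (-a)
  rw [zero_mul, mul_zero] at h0
  exact sub_eq_zero.1 (tendsto_nhds_unique
    (h.congr fun N => sum_range_qGaussTerm_sub a b hq hs N) h0)

theorem tsum_qGaussTerm_iterate {q s a b : ℂ} (hq : ‖q‖ < 1) (hab : ‖a * b‖ < 1)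
    (hs : ∀ k, s ^ 2 * q ^ k ≠ 1) (N : ℕ) :
    qShifted (a * b) q N * ∑' m, qGaussTerm a b s q m =
      qShifted (a * s) q N * ∑' m, qGaussTerm (a * q ^ N) b s q m := by
  induction N with
  | zero => simp
  | succ N ih =>
    have hab' : ‖a * q ^ N * b‖ < 1 := by
      rw [mul_right_comm, norm_mul, norm_pow]
      exact mul_lt_one_of_nonneg_of_lt_one_left (norm_nonneg _) hab
        (pow_le_one₀ (norm_nonneg q) hq.le)
    have h := tsum_qGaussTerm_mul hq hab' hs
    rw [qShifted_succ, qShifted_succ, pow_succ, ← mul_assoc a]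
    linear_combination (1 - a * b * q ^ N) * ih + qShifted (a * s) q N * h

/-- Replacing each numerator difference by a sum of norms dominates the terms uniformly in N; the
ratio of the majorant still tends to |ab| < 1. -/
theorem tendsto_tsum_qGaussTerm {q a b : ℂ} (s : ℂ) (hq : ‖q‖ < 1) (hab : ‖a * b‖ < 1) :
    Tendsto (fun N : ℕ => ∑' m, qGaussTerm (a * q ^ N) b s q m) atTop
      (𝓝 (∑' m, qGaussTerm 0 b s q m)) := by
  have hpow : Tendsto (fun k : ℕ => ‖s * q ^ k‖) atTop (𝓝 0) := by
    simpa using (tendsto_const_mul_pow s hq).norm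
  have hsum : Summable fun m => ∏ k ∈ Finset.range m,
      ((‖a‖ + ‖s * q ^ k‖) * (‖b‖ + ‖s * q ^ k‖) /
        (‖1 - q * q ^ k‖ * ‖1 - s ^ 2 * q ^ k‖)) := by
    refine summable_prod_range_of_tendsto (R := ℝ)
      (l := (‖a‖ + 0) * (‖b‖ + 0) / (‖(1 - 0 : ℂ)‖ * ‖(1 - 0 : ℂ)‖))
      (((hpow.const_add _).mul (hpow.const_add _)).div
      (((tendsto_const_mul_pow q hq).const_sub 1).norm.mul
      ((tendsto_const_mul_pow (s ^ 2) hq).const_sub 1).norm) (by simp)) (by simpa using hab)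
  refine tendsto_tsum_of_dominated_convergence hsum (fun m => ?_)
    (Eventually.of_forall fun N m => ?_)
  · simp only [qGaussTerm_eq_prod]
    refine tendsto_finsetProd _ fun k _ => ?_
    exact (((tendsto_const_mul_pow a hq).sub_const _).mul_const _).div_const _
  · rw [qGaussTerm_eq_prod, norm_prod]
    refine Finset.prod_le_prod (fun k _ => norm_nonneg _) fun k _ => ?_
    rw [norm_div, norm_mul, norm_mul (1 - q * q ^ k)]
    gcongr
    · refine (norm_sub_le _ _).trans (add_le_add_left ?_ _)
      rw [norm_mul, norm_pow]
      exact mul_le_of_le_one_right (norm_nonneg _) (pow_le_one₀ (norm_nonneg q) hq.le)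
    · exact norm_sub_le _ _

theorem qShiftedInf_mul_tsum_qGaussTerm {q s a b : ℂ} (hq : ‖q‖ < 1) (hab : ‖a * b‖ < 1)
    (hs : ∀ k, s ^ 2 * q ^ k ≠ 1) :
    qShiftedInf (a * b) q * ∑' m, qGaussTerm a b s q m =
      qShiftedInf (a * s) q * ∑' m, qGaussTerm 0 b s q m :=
  tendsto_nhds_unique (((tendsto_qShifted (a * b) hq).mul_const _).congr
    fun N => tsum_qGaussTerm_iterate hq hab hs N)
    ((tendsto_qShifted (a * s) hq).mul (tendsto_tsum_qGaussTerm s hq hab))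

theorem tsum_qGaussTerm_self (b s q : ℂ) : ∑' m, qGaussTerm s b s q m = 1 := by
  rw [tsum_eq_single 0]
  · simp [qGaussTerm]
  · intro m hm
    obtain ⟨m, rfl⟩ := Nat.exists_eq_succ_of_ne_zero hm
    have : shiftedDiff s s q (m + 1) = 0 :=
      Finset.prod_eq_zero (Finset.mem_range.2 m.succ_pos) (by simp)
    simp [qGaussTerm, this]

/-- The `q`-Gauss summation formula. -/
theorem qGauss_sum {q s a b : ℂ} (hq : ‖q‖ < 1) (hab : ‖a * b‖ < 1)
    (hs : ∀ k, s ^ 2 * q ^ k ≠ 1) :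
    qShiftedInf (a * b) q * qShiftedInf (s ^ 2) q * ∑' m, qGaussTerm a b s q m =
      qShiftedInf (a * s) q * qShiftedInf (b * s) q := by
  have h1 := qShiftedInf_mul_tsum_qGaussTerm hq hab hs
  -- The limit a → 0 and the symmetry in a, b reduce every series to the one at (0, 0). Its value
  -- comes from `h3`: at a = s the series stops after its first term.
  have h2 := qShiftedInf_mul_tsum_qGaussTerm (a := b) (b := 0) hq (by simp) hs
  have h3 := qShiftedInf_mul_tsum_qGaussTerm (a := s) (b := 0) hq (by simp) hs
  simp only [mul_zero, qShiftedInf_zero, one_mul, tsum_qGaussTerm_self, ← sq] at h2 h3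
  simp only [funext (qGaussTerm_comm 0 b s q)] at h1
  linear_combination qShiftedInf (s ^ 2) q * h1 +
    qShiftedInf (a * s) q * qShiftedInf (s ^ 2) q * h2 -
    qShiftedInf (a * s) q * qShiftedInf (b * s) q * h3

/-! ### Gauss's alternating sum via generating functions. -/

/-- The power series `∑ z^k / (q; q)_k`. -/
noncomputable def qExpSeries (q : ℂ) : PowerSeries ℂ :=
  PowerSeries.mk fun k => (qShifted q q k)⁻¹

theorem rescale_qExpSeries {q : ℂ} (hq : ‖q‖ < 1) :
    PowerSeries.rescale q (qExpSeries q) = (1 - PowerSeries.X) * qExpSeries q := by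
  ext k
  rw [sub_mul, one_mul, map_sub, PowerSeries.coeff_rescale]
  cases k with
  | zero => simp [qExpSeries]
  | succ k =>
    have h1 := qShifted_ne_zero (mul_pow_ne_one hq hq) k
    have h2 : 1 - q * q ^ k ≠ 0 := sub_ne_zero.2 (mul_pow_ne_one hq hq k).symm
    rw [PowerSeries.coeff_succ_X_mul]
    simp only [qExpSeries, PowerSeries.coeff_mk, qShifted_succ, pow_succ']
    generalize hx : q * q ^ k = x at h2 ⊢
    field_simp
    ring

/-- The product of `∑ (-z)^k / (q; q)_k` and `∑ z^k / (q; q)_k`. -/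
noncomputable def qGaussSeries (q : ℂ) : PowerSeries ℂ :=
  PowerSeries.rescale (-1) (qExpSeries q) * qExpSeries q

/-- This is the functional equation of 1/(z²;q²)_∞; comparing coefficients gives a two-step
recursion that fixes the even ones. -/
theorem rescale_qGaussSeries {q : ℂ} (hq : ‖q‖ < 1) :
    PowerSeries.rescale q (qGaussSeries q) = (1 - PowerSeries.X ^ 2) * qGaussSeries q := by
  have h : PowerSeries.rescale q (PowerSeries.rescale (-1) (qExpSeries q)) =
      (1 + PowerSeries.X) * PowerSeries.rescale (-1) (qExpSeries q) := by
    rw [PowerSeries.rescale_rescale, mul_comm, ← PowerSeries.rescale_rescale,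
      rescale_qExpSeries hq, map_mul, map_sub, map_one, PowerSeries.rescale_X]
    simp
  rw [qGaussSeries, map_mul, h, rescale_qExpSeries hq]
  ring

theorem coeff_qGaussSeries_even {q : ℂ} (hq : ‖q‖ < 1) (n : ℕ) :
    PowerSeries.coeff (2 * n) (qGaussSeries q) = (qShifted (q ^ 2) (q ^ 2) n)⁻¹ := by
  have hq2 : ‖q ^ 2‖ < 1 := by
    rw [norm_pow]; exact pow_lt_one₀ (norm_nonneg _) hq two_ne_zero
  induction n with
  | zero =>
    rw [mul_zero, qGaussSeries, PowerSeries.coeff_mul]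
    simp [qExpSeries, -PowerSeries.coeff_zero_eq_constantCoeff, PowerSeries.coeff_rescale]
  | succ n ih =>
    have h := congrArg (PowerSeries.coeff (2 * n + 2)) (rescale_qGaussSeries hq)
    rw [sub_mul, one_mul, map_sub, PowerSeries.coeff_rescale, PowerSeries.coeff_X_pow_mul, ih] at h
    have h2 : 1 - q ^ 2 * (q ^ 2) ^ n ≠ 0 := sub_ne_zero.2 (mul_pow_ne_one hq2 hq2 n).symm
    rw [qShifted_succ, mul_inv, ← div_eq_mul_inv, eq_div_iff h2, mul_add, mul_one]
    rw [pow_add, pow_mul] at h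
    linear_combination -h

/-- Gauss's alternating sum of `q`-binomial coefficients, centred at the middle index. -/
theorem sum_Icc_neg_one_zpow_div {q : ℂ} (hq : ‖q‖ < 1) (n : ℕ) :
    ∑ j ∈ Finset.Icc (-(n : ℤ)) n,
      (-1 : ℂ) ^ j / (qShifted q q (n - j.natAbs) * qShifted q q (n + j.natAbs)) =
      (-1) ^ n / qShifted (q ^ 2) (q ^ 2) n := by
  rw [div_eq_mul_inv _ (qShifted (q ^ 2) (q ^ 2) n), ← coeff_qGaussSeries_even hq, qGaussSeries,
    PowerSeries.coeff_mul, Finset.mul_sum, Finset.Nat.sum_antidiagonal_eq_sum_range_succ_mk]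
  -- The index i = n + j turns the centred sum into the coefficient of z^(2n).
  refine Finset.sum_nbij' (fun j => (n + j).toNat) (fun i => (i : ℤ) - n)
    ?_ ?_ ?_ ?_ ?_
  · intro j hj; simp at hj ⊢; omega
  · intro j hj; simp at hj ⊢; omega
  · intro j hj; simp at hj ⊢; omega
  · intro j hj; simp
  · intro j hj
    rw [Finset.mem_Icc] at hj
    simp only [PowerSeries.coeff_rescale, qExpSeries, PowerSeries.coeff_mk]
    have hsign : (-1 : ℂ) ^ j = (-1) ^ n * (-1) ^ (n + j).toNat := by
      rw [← zpow_natCast (-1 : ℂ) n, ← zpow_natCast (-1 : ℂ) (n + j).toNat,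
        Int.toNat_of_nonneg (by omega), ← zpow_add₀ (by norm_num), ← add_assoc,
        zpow_add₀ (by norm_num), Even.neg_one_zpow (⟨n, rfl⟩ : Even ((n : ℤ) + n)), one_mul]
    rw [hsign, div_eq_mul_inv, mul_inv, mul_assoc]
    rcases le_total 0 j with h | h
    · rw [show (n + j).toNat = n + j.natAbs by omega,
        show 2 * n - (n + j.natAbs) = n - j.natAbs by omega]
      ring
    · rw [show (n + j).toNat = n - j.natAbs by omega,
        show 2 * n - (n - j.natAbs) = n + j.natAbs by omega]
      ring

/-! ### The Bailey pair. -/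

theorem sum_Icc_telescope {q : ℂ} (hq : ‖q‖ < 1) (n d : ℕ) (hd : d ≤ n) :
    ∑ r ∈ Finset.Icc d n, (1 - q ^ (2 * r + 1)) * q ^ r ^ 2 /
      (qShifted q q (n - r) * qShifted q q (n + r + 1)) =
      q ^ d ^ 2 / (qShifted q q (n - d) * qShifted q q (n + d)) := by
  -- The case e = n is excluded: there the truncated n - (e + 1) would be 0, giving a spurious
  -- nonzero term. It is the base case below.
  have key : ∀ e, e < n → (1 - q ^ (2 * e + 1)) * q ^ e ^ 2 /
      (qShifted q q (n - e) * qShifted q q (n + e + 1)) =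
      q ^ e ^ 2 / (qShifted q q (n - e) * qShifted q q (n + e)) -
      q ^ (e + 1) ^ 2 / (qShifted q q (n - (e + 1)) * qShifted q q (n + (e + 1))) := by
    intro e he
    obtain ⟨m, rfl⟩ := Nat.exists_eq_add_of_lt he
    rw [show e + m + 1 - e = m + 1 by omega, show e + m + 1 - (e + 1) = m by omega,
      show e + m + 1 + (e + 1) = e + m + 1 + e + 1 by omega, qShifted_succ q q m,
      qShifted_succ q q (e + m + 1 + e)]
    have h1 := qShifted_ne_zero (mul_pow_ne_one hq hq) m
    have h2 := qShifted_ne_zero (mul_pow_ne_one hq hq) (e + m + 1 + e)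
    have h3 : 1 - q * q ^ m ≠ 0 := sub_ne_zero.2 (mul_pow_ne_one hq hq _).symm
    have h4 : 1 - q * q ^ (e + m + 1 + e) ≠ 0 := sub_ne_zero.2 (mul_pow_ne_one hq hq _).symm
    generalize hd3 : 1 - q * q ^ m = d3 at h3 ⊢
    generalize hd4 : 1 - q * q ^ (e + m + 1 + e) = d4 at h4 ⊢
    field_simp
    rw [← hd3, ← hd4]
    ring
  induction hd using Nat.decreasingInduction with
  | self =>
    have h3 : 1 - q * q ^ (n + n) ≠ 0 := sub_ne_zero.2 (mul_pow_ne_one hq hq _).symm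
    have h2 := qShifted_ne_zero (mul_pow_ne_one hq hq) (n + n)
    rw [Finset.Icc_self, Finset.sum_singleton, qShifted_succ, Nat.sub_self, qShifted_zero,
      show q ^ (2 * n + 1) = q * q ^ (n + n) by ring]
    generalize 1 - q * q ^ (n + n) = x at h3 ⊢
    field_simp
  | of_succ e he ih =>
    rw [← Finset.add_sum_Ioc_eq_sum_Icc he.le, ← Finset.Icc_add_one_left_eq_Ioc, ih, key e he]
    ring

/-- The alternating sum `∑_{|j| ≤ r} (-1)^j q^(r^2 - j^2)`. -/
noncomputable def heckeInnerSum (q : ℂ) (r : ℕ) : ℂ :=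
  ∑ j ∈ Finset.Icc (-(r : ℤ)) r, (-1 : ℂ) ^ j * q ^ ((r : ℤ) ^ 2 - j ^ 2)

/-- The Bailey pair relative to `q` underlying the Hecke-type identity. -/
theorem sum_heckeInnerSum_div {q : ℂ} (hq0 : q ≠ 0) (hq : ‖q‖ < 1) (n : ℕ) :
    ∑ r ∈ Finset.range (n + 1), (1 - q ^ (2 * r + 1)) * heckeInnerSum q r /
      (qShifted q q (n - r) * qShifted q q (n + r + 1)) =
      (-1) ^ n / qShifted (q ^ 2) (q ^ 2) n := by
  simp only [heckeInnerSum, Finset.mul_sum, Finset.sum_div]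
  -- For fixed j the sum over r ≥ |j| telescopes to a multiple of q^(j²), which cancels the factor
  -- q^(-j²) and leaves Gauss's sum.
  rw [Finset.sum_comm' (t' := Finset.Icc (-(n : ℤ)) n) (s' := fun j => Finset.Icc j.natAbs n)
    (by intro r j; simp only [Finset.mem_range, Finset.mem_Icc]; omega),
    ← sum_Icc_neg_one_zpow_div hq n]
  refine Finset.sum_congr rfl fun j hj => ?_
  have hjn : j.natAbs ≤ n := by rw [Finset.mem_Icc] at hj; omega
  have hj2 : q ^ j ^ 2 = q ^ j.natAbs ^ 2 := by
    rw [← zpow_natCast, Nat.cast_pow, Int.natCast_natAbs, sq_abs]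
  have hne : q ^ j.natAbs ^ 2 ≠ 0 := pow_ne_zero _ hq0
  have h := congrArg (fun x => (-1 : ℂ) ^ j / q ^ j.natAbs ^ 2 * x)
    (sum_Icc_telescope hq n j.natAbs hjn)
  simp only [Finset.mul_sum] at h
  refine (Finset.sum_congr rfl fun r _ => ?_).trans (h.trans ?_)
  · have : q ^ (r : ℤ) ^ 2 = q ^ r ^ 2 := by rw [← zpow_natCast, Nat.cast_pow]
    rw [zpow_sub₀ hq0, hj2, this]
    ring
  · field_simp

/-! ### Absolute convergence of the double series. -/

theorem norm_heckeInnerSum_le {q : ℂ} (hq : ‖q‖ < 1) (r : ℕ) :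
    ‖heckeInnerSum q r‖ ≤ 2 * r + 1 := by
  refine (norm_sum_le_of_le _ (n := fun _ => (1 : ℝ)) fun j hj => ?_).trans (le_of_eq ?_)
  · obtain ⟨m, hm⟩ := Int.eq_ofNat_of_zero_le (a := (r : ℤ) ^ 2 - j ^ 2) (by
      rw [Finset.mem_Icc] at hj; nlinarith)
    rw [hm, norm_mul, norm_zpow, norm_neg, norm_one, one_zpow, one_mul, zpow_natCast, norm_pow]
    exact pow_le_one₀ (norm_nonneg q) hq.le
  · rw [Finset.sum_const, Int.card_Icc, nsmul_eq_mul, mul_one,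
      show ((r : ℤ) + 1 - -r).toNat = 2 * r + 1 by omega]
    push_cast
    ring

/-- For |ab| < ρ < 1, dividing each pair of factors by ρ leaves a limiting ratio below 1, so the
rescaled products tend to 0 and are bounded. -/
theorem exists_bound_shiftedDiff_mul {a b q : ℂ} (s : ℂ) (hq : ‖q‖ < 1) (hab : ‖a * b‖ < 1) :
    ∃ C ρ : ℝ, 0 ≤ C ∧ 0 ≤ ρ ∧ ρ < 1 ∧
      ∀ n, ‖shiftedDiff a s q n * shiftedDiff b s q n‖ ≤ C * ρ ^ n := by
  obtain ⟨ρ, hρ, hρ1⟩ := exists_between hab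
  have hρ0 : 0 < ρ := (norm_nonneg _).trans_lt hρ
  have hρc : (ρ : ℂ) ≠ 0 := by exact_mod_cast hρ0.ne'
  have hs := summable_prod_range_of_tendsto (R := ℂ) (l := (a - 0) * (b - 0) / ρ)
    ((((tendsto_const_mul_pow s hq).const_sub a).mul
    ((tendsto_const_mul_pow s hq).const_sub b)).div_const (ρ : ℂ))
    (by rw [sub_zero, sub_zero, norm_div, Complex.norm_real, Real.norm_of_nonneg hρ0.le]
        exact (div_lt_one hρ0).2 hρ)
  obtain ⟨C, hC⟩ := hs.tendsto_atTop_zero.norm.bddAbove_range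
  have hC' : ∀ n, ‖∏ k ∈ Finset.range n, (a - s * q ^ k) * (b - s * q ^ k) / (ρ : ℂ)‖ ≤ C :=
    fun n => hC ⟨n, rfl⟩
  refine ⟨C, ρ, (norm_nonneg _).trans (hC' 0), hρ0.le, hρ1, fun n => ?_⟩
  have h := hC' n
  rw [Finset.prod_div_distrib, Finset.prod_mul_distrib, Finset.prod_const, Finset.card_range,
    norm_div, norm_pow, Complex.norm_real, Real.norm_of_nonneg hρ0.le,
    div_le_iff₀ (pow_pos hρ0 n)] at h
  exact h

theorem exists_bound_inv_qShifted {q : ℂ} (hq : ‖q‖ < 1) :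
    ∃ B : ℝ, 0 ≤ B ∧ ∀ n, ‖(qShifted q q n)⁻¹‖ ≤ B := by
  obtain ⟨B, hB⟩ := ((tendsto_qShifted q hq).inv₀
    (qShiftedInf_ne_zero hq (mul_pow_ne_one hq hq))).norm.bddAbove_range
  exact ⟨B, (norm_nonneg _).trans (hB ⟨0, rfl⟩), fun n => hB ⟨n, rfl⟩⟩

/-- The summand, indexed by `r` and `m = n - r`, of the double series obtained by inserting the
Bailey pair into `∑ (q/a, q/b; q)_n (ab)^n β_n`. -/
noncomputable def baileyTerm (a b q : ℂ) (p : ℕ × ℕ) : ℂ :=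
  shiftedDiff a q q (p.1 + p.2) * shiftedDiff b q q (p.1 + p.2) *
    ((1 - q ^ (2 * p.1 + 1)) * heckeInnerSum q p.1 *
      ((qShifted q q p.2)⁻¹ * (qShifted q q (2 * p.1 + 1 + p.2))⁻¹))

theorem summable_baileyTerm {a b q : ℂ} (hq : ‖q‖ < 1) (hab : ‖a * b‖ < 1) :
    Summable (baileyTerm a b q) := by
  obtain ⟨C, ρ, hC, hρ0, hρ1, hδ⟩ := exists_bound_shiftedDiff_mul q hq hab
  obtain ⟨B, hB0, hB⟩ := exists_bound_inv_qShifted hq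
  have hg := summable_geometric_of_lt_one hρ0 hρ1
  have h1 : Summable fun r : ℕ => (2 * r + 1 : ℝ) * ρ ^ r := by
    have := ((summable_pow_mul_geometric_of_norm_lt_one 1
      (by rwa [Real.norm_of_nonneg hρ0] : ‖ρ‖ < 1)).mul_left 2).add hg
    refine this.congr fun r => ?_
    rw [pow_one]
    ring
  have h2 := (h1.mul_of_nonneg hg (fun r => by positivity) fun m => by positivity).mul_left
    (C * 2 * (B * B))
  refine Summable.of_norm_bounded h2 fun p => ?_
  have h3 : ‖1 - q ^ (2 * p.1 + 1)‖ ≤ 2 := by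
    refine (norm_sub_le _ _).trans ?_
    rw [norm_one, norm_pow]
    linarith [pow_le_one₀ (norm_nonneg q) hq.le (n := 2 * p.1 + 1)]
  calc ‖baileyTerm a b q p‖
      ≤ C * ρ ^ (p.1 + p.2) * (2 * (2 * p.1 + 1) * (B * B)) := by
        rw [baileyTerm, norm_mul _ (_ * _ * _), norm_mul (_ * _) (_ * _), norm_mul (1 - _),
          norm_mul (_)⁻¹]
        gcongr
        · exact hδ _
        · exact norm_heckeInnerSum_le hq _
        · exact hB _
        · exact hB _
    _ = _ := by ring

/-! ### Summation by diagonals and by rows. -/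

theorem sum_antidiagonal_baileyTerm {a b q : ℂ} (hq0 : q ≠ 0) (hq : ‖q‖ < 1) (n : ℕ) :
    ∑ p ∈ Finset.HasAntidiagonal.antidiagonal n, baileyTerm a b q p =
      shiftedDiff a q q n * shiftedDiff b q q n * (-1) ^ n / qShifted (q ^ 2) (q ^ 2) n := by
  rw [mul_div_assoc, ← sum_heckeInnerSum_div hq0 hq n, Finset.mul_sum,
    Finset.Nat.sum_antidiagonal_eq_sum_range_succ_mk]
  refine Finset.sum_congr rfl fun r hr => ?_
  rw [Finset.mem_range] at hr
  rw [baileyTerm]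
  simp only
  rw [show r + (n - r) = n by omega, show 2 * r + 1 + (n - r) = n + r + 1 by omega, ← mul_inv,
    ← div_eq_mul_inv]

theorem baileyTerm_eq_mul_qGaussTerm (a b q : ℂ) (r m : ℕ) :
    baileyTerm a b q (r, m) = (1 - q ^ (2 * r + 1)) * heckeInnerSum q r *
      (shiftedDiff a q q r * shiftedDiff b q q r) * (qShifted q q (2 * r + 1))⁻¹ *
      qGaussTerm a b (q ^ (r + 1)) q m := by
  rw [baileyTerm, qGaussTerm]
  simp only
  rw [shiftedDiff_add, shiftedDiff_add, qShifted_add, show q * q ^ r = q ^ (r + 1) by ring,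
    show q * q ^ (2 * r + 1) = (q ^ (r + 1)) ^ 2 by ring, mul_inv, div_eq_mul_inv, mul_inv]
  ring

theorem tsum_baileyTerm {a b q : ℂ} (hq : ‖q‖ < 1) (hab : ‖a * b‖ < 1)
    (ha : ∀ k, q * a * q ^ k ≠ 1) (hb : ∀ k, q * b * q ^ k ≠ 1) (r : ℕ) :
    qShiftedInf q q * qShiftedInf (a * b) q / (qShiftedInf (q * a) q * qShiftedInf (q * b) q) *
      ∑' m, baileyTerm a b q (r, m) =
      (1 - q ^ (2 * r + 1)) * (shiftedDiff a q q r * shiftedDiff b q q r) /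
        (qShifted (q * a) q r * qShifted (q * b) q r) * heckeInnerSum q r := by
  simp only [baileyTerm_eq_mul_qGaussTerm, tsum_mul_left]
  have hqq := mul_pow_ne_one hq hq
  have hs : ‖(q ^ (r + 1)) ^ 2‖ < 1 := by
    rw [← pow_mul, norm_pow]
    exact pow_lt_one₀ (norm_nonneg q) hq (by omega)
  have hG := qGauss_sum hq hab (mul_pow_ne_one hs hq)
  -- Splitting off 2r+1, r and r factors leaves exactly the tails that occur in q-Gauss with s =
  -- q^(r+1).
  have e1 := qShiftedInf_eq_mul q hq (2 * r + 1)
  have e2 := qShiftedInf_eq_mul (q * a) hq r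
  have e3 := qShiftedInf_eq_mul (q * b) hq r
  rw [show q * q ^ (2 * r + 1) = (q ^ (r + 1)) ^ 2 by ring] at e1
  rw [show q * a * q ^ r = a * q ^ (r + 1) by ring] at e2
  rw [show q * b * q ^ r = b * q ^ (r + 1) by ring] at e3
  have n1 := qShifted_ne_zero hqq (2 * r + 1)
  have n2 := qShifted_ne_zero ha r
  have n3 := qShifted_ne_zero hb r
  have n4 := qShiftedInf_ne_zero hq ha
  have n5 := qShiftedInf_ne_zero hq hb
  rw [e2] at n4
  rw [e3] at n5
  have n6 := right_ne_zero_of_mul n4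
  have n7 := right_ne_zero_of_mul n5
  rw [e1, e2, e3]
  generalize qShiftedInf (a * q ^ (r + 1)) q = A at *
  generalize qShiftedInf (b * q ^ (r + 1)) q = B at *
  generalize qShifted (q * a) q r = A' at *
  generalize qShifted (q * b) q r = B' at *
  generalize 1 - q ^ (2 * r + 1) = c at *
  generalize ∑' m, qGaussTerm a b (q ^ (r + 1)) q m = G at *
  field_simp
  linear_combination (c * heckeInnerSum q r * shiftedDiff a q q r * shiftedDiff b q q r) * hG

theorem hasSum_hecke_type {a b q : ℂ} (hq0 : q ≠ 0) (hq : ‖q‖ < 1) (hab : ‖a * b‖ < 1)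
    (ha : ∀ k, q * a * q ^ k ≠ 1) (hb : ∀ k, q * b * q ^ k ≠ 1) :
    Summable (fun n : ℕ => shiftedDiff a q q n * shiftedDiff b q q n * (-1) ^ n /
      qShifted (q ^ 2) (q ^ 2) n) ∧
    HasSum (fun r : ℕ => (1 - q ^ (2 * r + 1)) * (shiftedDiff a q q r * shiftedDiff b q q r) /
        (qShifted (q * a) q r * qShifted (q * b) q r) * heckeInnerSum q r)
      (qShiftedInf q q * qShiftedInf (a * b) q / (qShiftedInf (q * a) q * qShiftedInf (q * b) q) *
        ∑' n : ℕ, shiftedDiff a q q n * shiftedDiff b q q n * (-1) ^ n /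
          qShifted (q ^ 2) (q ^ 2) n) := by
  have hK := summable_baileyTerm hq hab (a := a) (b := b)
  have h1 := (Finset.HasAntidiagonal.sigmaAntidiagonalEquivProd.hasSum_iff.2 hK.hasSum).sigma
    fun n => hasSum_fintype _
  have h2 : HasSum (fun n : ℕ => shiftedDiff a q q n * shiftedDiff b q q n * (-1) ^ n /
      qShifted (q ^ 2) (q ^ 2) n) (∑' p, baileyTerm a b q p) := by
    refine h1.congr_fun fun n => ?_
    rw [← sum_antidiagonal_baileyTerm hq0 hq n]
    exact (Finset.sum_coe_sort (Finset.HasAntidiagonal.antidiagonal n) (baileyTerm a b q)).symm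
  refine ⟨h2.summable, ?_⟩
  rw [h2.tsum_eq]
  have h3 := (hK.hasSum.prod_fiberwise fun r => (hK.prod_factor r).hasSum).mul_left
    (qShiftedInf q q * qShiftedInf (a * b) q / (qShiftedInf (q * a) q * qShiftedInf (q * b) q))
  simpa only [tsum_baileyTerm hq hab ha hb] using h3

/-! ### Specialisation and the final statement. -/

theorem shiftedDiff_zero_left (q : ℂ) (n : ℕ) :
    shiftedDiff 0 q q n = (-1) ^ n * q ^ (n * (n + 1) / 2) := by
  induction n with
  | zero => simp
  | succ n ih =>
    rw [shiftedDiff_succ, ih, show (n + 1) * (n + 1 + 1) / 2 = n * (n + 1) / 2 + (n + 1) by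
      rw [← Nat.add_mul_div_right _ _ two_pos]; congr 1; ring]
    ring

theorem qShifted_sq (q : ℂ) (n : ℕ) :
    qShifted (q ^ 2) (q ^ 2) n = qShifted q q n * qShifted (-q) q n := by
  simp only [qShifted, ← Finset.prod_mul_distrib]
  exact Finset.prod_congr rfl fun k _ => by ring

theorem mainTheorem3 (q : ℝ) (hq0 : 0 < q) (hq1 : q < 1) :
    -- the Hecke-type identity; `qShiftedScaled a q n` is `(q/a; q)_n a ^ n`
    (∀ a b : ℂ, ‖a * b‖ < 1 →
      (∀ k : ℕ, 1 ≤ k → a * (q : ℂ) ^ k ≠ 1) →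
      (∀ k : ℕ, 1 ≤ k → b * (q : ℂ) ^ k ≠ 1) →
      Summable (fun n : ℕ =>
        qShiftedScaled a q n * qShiftedScaled b q n * (-1) ^ n
          / qShifted ((q : ℂ) ^ 2) ((q : ℂ) ^ 2) n) ∧
      HasSum (fun n : ℕ => ∑ j ∈ Finset.Icc (-(n : ℤ)) (n : ℤ),
          (-1 : ℂ) ^ j *
            ((1 - (q : ℂ) ^ (2 * n + 1)) * (qShiftedScaled a q n * qShiftedScaled b q n)
                * (q : ℂ) ^ ((n : ℤ) ^ 2 - j ^ 2)
              / (qShifted (q * a) q n * qShifted (q * b) q n)))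
        ((qShiftedInf q q * qShiftedInf (a * b) q)
            / (qShiftedInf (q * a) q * qShiftedInf (q * b) q)
          * ∑' n : ℕ,
              qShiftedScaled a q n * qShiftedScaled b q n * (-1) ^ n
                / qShifted ((q : ℂ) ^ 2) ((q : ℂ) ^ 2) n)) ∧
    -- the Andrews-Dyson-Hickerson identity (the case `a = 1`, `b = 0`)
    (Summable (fun n : ℕ => (q : ℂ) ^ (n * (n + 1) / 2) / qShifted (-q) q n) ∧
      HasSum (fun n : ℕ => ∑ j ∈ Finset.Icc (-(n : ℤ)) (n : ℤ),
          (-1 : ℂ) ^ ((n : ℤ) + j) * (1 - (q : ℂ) ^ (2 * n + 1))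
            * (q : ℂ) ^ ((3 * (n : ℤ) ^ 2 + n) / 2 - j ^ 2))
        (∑' n : ℕ, (q : ℂ) ^ (n * (n + 1) / 2) / qShifted (-q) q n)) := by
  have hq0' : (q : ℂ) ≠ 0 := by exact_mod_cast hq0.ne'
  have hq : ‖(q : ℂ)‖ < 1 := by rwa [Complex.norm_real, Real.norm_of_nonneg hq0.le]
  refine ⟨fun a b hab ha hb => ?_, ?_⟩
  · obtain ⟨h1, h2⟩ := hasSum_hecke_type hq0' hq hab
      (fun k h => ha (k + 1) (by omega) (by rw [← h]; ring))
      (fun k h => hb (k + 1) (by omega) (by rw [← h]; ring))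
    simp only [qShiftedScaled_eq_shiftedDiff]
    refine ⟨h1, h2.congr_fun fun n => ?_⟩
    rw [heckeInnerSum, Finset.mul_sum]
    exact Finset.sum_congr rfl fun j _ => by ring
  · have hqq := mul_pow_ne_one hq hq
    obtain ⟨h1, h2⟩ := hasSum_hecke_type (a := 1) (b := 0) hq0' hq (by simp)
      (by simpa using hqq) (by simp)
    have hterm : ∀ n : ℕ, shiftedDiff 1 q q n * shiftedDiff 0 q q n * (-1) ^ n /
        qShifted ((q : ℂ) ^ 2) ((q : ℂ) ^ 2) n =
        (q : ℂ) ^ (n * (n + 1) / 2) / qShifted (-q) q n := fun n => by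
      have hs : (-1 : ℂ) ^ n * (-1) ^ n = 1 := by rw [← mul_pow]; simp
      rw [shiftedDiff_zero_left, qShifted_sq, ← mul_div_mul_left (_ ^ _) _ (qShifted_ne_zero hqq n),
        show shiftedDiff 1 q q n = qShifted q q n from rfl]
      congr 1
      linear_combination qShifted q q n * (q : ℂ) ^ (n * (n + 1) / 2) * hs
    simp only [hterm, mul_one, mul_zero, qShiftedInf_zero,
      div_self (qShiftedInf_ne_zero hq hqq), one_mul] at h1 h2
    refine ⟨h1, h2.congr_fun fun n => ?_⟩
    have hn := qShifted_ne_zero hqq n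
    -- The integer division is exact, since 3n² + n = n(n+1) + 2n².
    have hexp : (3 * (n : ℤ) ^ 2 + n) / 2 = ((n * (n + 1) / 2 : ℕ) : ℤ) + (n : ℤ) ^ 2 := by
      push_cast
      rw [← Int.add_mul_ediv_right _ _ (by norm_num)]
      congr 1
      ring
    rw [shiftedDiff_zero_left, show shiftedDiff 1 q q n = qShifted q q n from rfl,
      show qShifted 0 (q : ℂ) n = 1 by simp [qShifted],
      mul_one, mul_left_comm,
      mul_div_cancel_left₀ _ hn, heckeInnerSum, Finset.mul_sum]
    refine Finset.sum_congr rfl fun j _ => ?_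
    rw [hexp, add_sub_assoc, zpow_add₀ hq0', zpow_add₀ (by norm_num), zpow_natCast, zpow_natCast]
    ring
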